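/- Let $n\ge 2$ and $\varepsilon\in\{\pm1\}$. Let $V$ be a finite-dimensional complex vector space of dimension $v$ with an $\varepsilon$-form, i.e. a nondegenerate bilinear form with $(u,u')=\varepsilon(u',u)$. Let $\mathcal N_{n,v,\varepsilon}$ be the set of nilpotent $x$ in the Lie algebra of the isometry group of $V$ with $x^n=0$. Let $\mathcal F_{n,v,\varepsilon}$ be the variety of flags $0=F_0\subseteq F_1\subseteq\dots\subseteq F_n=V$ with $F_i^\perp=F_{n-i}$ for all $i$. Let $\mathcal M_{n,v,\varepsilon}$ be its cotangent bundle, i.e. the set of pairs $(x,F)\in\mathcal N_{n,v,\varepsilon}\times\mathcal F_{n,v,\varepsilon}$ with $x(F_i)\subseteq F_{i-1}$ for $1\le i\le n$, and let $\pi(x,F)=x$. On $\mathbb C^{2n}$ fix a basis $a_1,\dots,a_n,b_1,\dots,b_n$ and the $\varepsilon$-form with $(a_i,b_j)=\delta_{ij}$, $(a_i,a_j)=(b_i,b_j)=0$. Let $e_\varepsilon$ be given by $a_i\mapsto a_{i-1}$, $b_i\mapsto -b_{i+1}$ (with $a_0=b_{n+1}=0$), and let $\mathbf F_\varepsilon$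 be the flag whose $i$-th step is $\langle a_1,\dots,a_i,b_n,\dots,b_{n+1-i}\rangle$. Equip $V\oplus\mathbb C^{2n}$ with the direct sum form, and put $i_\varepsilon(x)=x\oplus e_\varepsilon$ and $i_{\mathcal M}(x,F)=(x\oplus e_\varepsilon,F\oplus\mathbf F_\varepsilon)$, where the flags are added step by step. (1) The direct sum form on $V\oplus\mathbb C^{2n}$ is an $\varepsilon$-form, and $i_\varepsilon:\mathcal N_{n,v,\varepsilon}\to\mathcal N_{n,v+2n,\varepsilon}$, $i_{\mathcal M}:\mathcal M_{n,v,\varepsilon}\to\mathcal M_{n,v+2n,\varepsilon}$ are well defined with $\pi\circ i_{\mathcal M}=i_\varepsilon\circ\pi$. This square is cartesian: for all $x\in\mathcal N_{n,v,\varepsilon}$, $$i_{\mathcal M}(\pi^{-1}(x))=\pi^{-1}(x\oplus e_\varepsilon);$$ each $m'\in\mathcal M_{n,v+2n,\varepsilon}$ with $\pi(m')=i_\varepsilon(x)$ comes from exactly one $m\in\mathcal M_{n,v,\varepsilon}$ with $i_{\mathcal M}(m)=m'$ and $\pi(m)=x$; and $i_{\mathcal M}$ is an isomorphism of varieties from $\mathcal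 M_{n,v,\varepsilon}$ onto $\pi^{-1}(i_\varepsilon(\mathcal N_{n,v,\varepsilon}))\subseteq\mathcal M_{n,v+2n,\varepsilon}$. (2) Spaltenstein varieties are unchanged under the row reduction that removes two rows of length $n$: let $x\in\mathcal N_{n,v,\varepsilon}$. The Jordan type of $x\oplus e_\varepsilon$ is that of $x$ with two parts $n$ added, that is, $\dim\ker (x\oplus e_\varepsilon)^k=\dim\ker x^k+2\min(k,n)$ for all $k\ge0$. The map $i_{\mathcal M}$ restricts to an isomorphism of varieties $\pi^{-1}(x)\to\pi^{-1}(x\oplus e_\varepsilon)$. For every $d=(d_1,\dots,d_n)\in\mathbb N^n$ it restricts to an isomorphism from the Spaltenstein variety $\{(x,F)\in\pi^{-1}(x):\dim F_i/F_{i-1}=d_i\ \forall i\}$ onto the Spaltenstein variety of $x\oplus e_\varepsilon$ of type $(d_1+2,\dots,d_n+2)$. Consequently the former is also isomorphic, as a variety, to the Spaltenstein variety of type $(d_1+2,\dots,d_n+2)$ of any $x'\in\mathrm{End}(V')$, where $V'$ is a space with a bilinear form and $x'$ is the conjugate of $x\oplus e_\varepsilon$ under some linear isometry $V\oplus\mathbb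 C^{2n}\cong V'$. -/

import Mathlib

noncomputable section

namespace Nilcone

/-! ### Complex algebraic sets of pairs (endomorphism, flag of subspaces)

Points are pairs `(x, F)` of an endomorphism `x` of `V` and a sequence `F 0, …, F n` of subspaces
of `V`.  The algebraic structure is that of `End V` times a product of (disjoint unions of)
Grassmannians, a Grassmannian of `k`-planes being the quotient of the variety of linearly
independent `k`-tuples of vectors by `GL k`: a set is Zariski open, and a function is regular, if
it is so after pulling back to pairs `(x, A)` where `A i` is a basis of `F i`. -/

/-- The ring of polynomial functions on a complex vector space. -/
def polyFun (E : Type*) [AddCommGroup E] [Module ℂ E] : Subalgebra ℂ (E → ℂ) :=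
  Algebra.adjoin ℂ (Set.range fun (l : Module.Dual ℂ E) (e : E) => l e)

/-- Pairs of an endomorphism and a sequence of `n + 1` subspaces. -/
abbrev Pt (n : ℕ) (V : Type*) [AddCommGroup V] [Module ℂ V] : Type _ :=
  Module.End ℂ V × (Fin (n + 1) → Submodule ℂ V)

/-- Pairs of an endomorphism and a sequence of tuples of vectors of lengths `D 0, …, D n`. -/
abbrev PreFrame {n : ℕ} (V : Type*) [AddCommGroup V] [Module ℂ V] (D : Fin (n + 1) → ℕ) : Type _ :=
  Module.End ℂ V × ((i : Fin (n + 1)) → Fin (D i) → V)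

section Varieties

variable {n : ℕ} {V : Type*} [AddCommGroup V] [Module ℂ V]
variable {V' : Type*} [AddCommGroup V'] [Module ℂ V']

/-- All the tuples are linearly independent. -/
def IsFrame {D : Fin (n + 1) → ℕ} (a : PreFrame V D) : Prop :=
  ∀ i, LinearIndependent ℂ (a.2 i)

/-- The pair (endomorphism, spans of the tuples). -/
def toPt {D : Fin (n + 1) → ℕ} (a : PreFrame V D) : Pt n V :=
  (a.1, fun i => Submodule.span ℂ (Set.range (a.2 i)))

/-- `U` is a Zariski open subset of `Z`. -/
def IsZariskiOpenIn (Z U : Set (Pt n V)) : Prop :=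
  U ⊆ Z ∧ ∀ (D : Fin (n + 1) → ℕ) (a : PreFrame V D), IsFrame a → toPt a ∈ U →
    ∃ q ∈ polyFun (PreFrame V D), q a ≠ 0 ∧
      ∀ b : PreFrame V D, IsFrame b → toPt b ∈ Z → q b ≠ 0 → toPt b ∈ U

/-- `f` is a regular function on `U`: locally a quotient of polynomials. -/
def IsRegularOn (U : Set (Pt n V)) (f : Pt n V → ℂ) : Prop :=
  ∀ (D : Fin (n + 1) → ℕ) (a : PreFrame V D), IsFrame a → toPt a ∈ U →
    ∃ p ∈ polyFun (PreFrame V D), ∃ q ∈ polyFun (PreFrame V D), q a ≠ 0 ∧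
      ∀ b : PreFrame V D, IsFrame b → toPt b ∈ U → q b ≠ 0 → f (toPt b) = p b / q b

/-- `φ` is a morphism of varieties from `Z` to `Z'`: it is continuous for the Zariski topologies
and pulls regular functions on open sets back to regular functions. -/
def IsVarietyMorphism (φ : Pt n V → Pt n V') (Z : Set (Pt n V)) (Z' : Set (Pt n V')) : Prop :=
  Set.MapsTo φ Z Z' ∧
  ∀ U' : Set (Pt n V'), IsZariskiOpenIn Z' U' →
    IsZariskiOpenIn Z (Z ∩ φ ⁻¹' U') ∧
    ∀ f : Pt n V' → ℂ, IsRegularOn U' f → IsRegularOn (Z ∩ φ ⁻¹' U') (f ∘ φ)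

/-- `φ` restricts to an isomorphism of varieties from `Z` onto `Z'`. -/
def IsVarietyIso (φ : Pt n V → Pt n V') (Z : Set (Pt n V)) (Z' : Set (Pt n V')) : Prop :=
  IsVarietyMorphism φ Z Z' ∧
  ∃ ψ : Pt n V' → Pt n V, IsVarietyMorphism ψ Z' Z ∧ Set.InvOn ψ φ Z Z'

end Varieties

/-! ### Nilcones, isotropic flags and Spaltenstein varieties -/

section Classical

variable {V : Type*} [AddCommGroup V] [Module ℂ V]

/-- A nondegenerate bilinear form with `(u, w) = ε (w, u)`, where `ε = ±1`. -/
def IsEpsForm (ε : ℤˣ) (B : LinearMap.BilinForm ℂ V) : Prop :=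
  B.Nondegenerate ∧ ∀ u w : V, B u w = ((ε : ℤ) : ℂ) * B w u

/-- The `n`-nilcone: nilpotent elements `x` of the Lie algebra of the isometry group of `B`
with `x ^ n = 0`. -/
def nilcone (B : LinearMap.BilinForm ℂ V) (n : ℕ) : Set (Module.End ℂ V) :=
  {x | x ∈ skewAdjointLieSubalgebra B ∧ IsNilpotent x ∧ x ^ n = 0}

/-- Isotropic `n`-step flags. -/
def isotropicFlags (B : LinearMap.BilinForm ℂ V) (n : ℕ) :
    Set (Fin (n + 1) → Submodule ℂ V) :=
  {F | F 0 = ⊥ ∧ F (Fin.last n) = ⊤ ∧ Monotone F ∧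
    ∀ i : Fin (n + 1), B.orthogonal (F i) = F i.rev}

/-- The cotangent bundle of the variety of isotropic `n`-step flags, as a set of pairs. -/
def cotangentFlags (B : LinearMap.BilinForm ℂ V) (n : ℕ) : Set (Pt n V) :=
  {m | m.1 ∈ nilcone B n ∧ m.2 ∈ isotropicFlags B n ∧
    ∀ i : Fin n, (m.2 i.succ).map m.1 ≤ m.2 i.castSucc}

/-- The projection to the nilcone. -/
def proj {n : ℕ} (m : Pt n V) : Module.End ℂ V := m.1

/-- The fibre of the projection from the cotangent bundle to the nilcone. -/
def fiber (B : LinearMap.BilinForm ℂ V) (n : ℕ) (x : Module.End ℂ V) : Set (Pt n V) :=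
  {m | m ∈ cotangentFlags B n ∧ proj m = x}

/-- The flags whose successive quotients have dimensions `d 0, …, d (n - 1)`. -/
def HasDims {n : ℕ} (F : Fin (n + 1) → Submodule ℂ V) (d : Fin n → ℕ) : Prop :=
  ∀ i : Fin n, Module.finrank ℂ (F i.succ) = Module.finrank ℂ (F i.castSucc) + d i

/-- The Spaltenstein variety of `x` and of the isotropic flags of type `d`. -/
def spaltenstein (B : LinearMap.BilinForm ℂ V) {n : ℕ} (d : Fin n → ℕ) (x : Module.End ℂ V) :
    Set (Pt n V) :=
  {m | m ∈ fiber B n x ∧ HasDims m.2 d}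

end Classical

/-! ### The space `ℂ^{2n}` with its form, nilpotent element and flag -/

/-- `ℂ^{2n}`, with coordinates in two blocks of length `n`. -/
abbrev Std (n : ℕ) : Type := Fin n ⊕ Fin n → ℂ

/-- The nilpotent Jordan block. -/
def jordanBlock (n : ℕ) : Matrix (Fin n) (Fin n) ℂ :=
  Matrix.of fun i j => if (i : ℕ) + 1 = j then 1 else 0

/-- The antidiagonal matrix. -/
def antiDiag (n : ℕ) : Matrix (Fin n) (Fin n) ℂ :=
  Matrix.of fun i j => if j = i.rev then 1 else 0

/-- The bilinear form on `ℂ^{2n}` with matrix `[[0, J], [ε J, 0]]`. -/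
def stdForm (ε : ℤˣ) (n : ℕ) : LinearMap.BilinForm ℂ (Std n) :=
  Matrix.toBilin' (Matrix.fromBlocks 0 (antiDiag n) (((ε : ℤ) : ℂ) • antiDiag n) 0)

/-- The nilpotent endomorphism of `ℂ^{2n}` with matrix `[[e, 0], [0, -e]]`. -/
def stdNilp (n : ℕ) : Module.End ℂ (Std n) :=
  Matrix.toLin' (Matrix.fromBlocks (jordanBlock n) 0 0 (-jordanBlock n))

/-- The vectors `a_1, …, a_n` (indexed from `0`). -/
def aVec {n : ℕ} (i : Fin n) : Std n := Pi.single (Sum.inl i) 1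

/-- The vectors `b_1, …, b_n` (indexed from `0`), numbered so that `(a_i, b_j) = δ_{ij}`. -/
def bVec {n : ℕ} (i : Fin n) : Std n := Pi.single (Sum.inr i.rev) 1

theorem stdForm_aVec_bVec (ε : ℤˣ) {n : ℕ} (i j : Fin n) :
    stdForm ε n (aVec i) (bVec j) = if i = j then 1 else 0 := by
  have h : (j = i) = (i = j) := propext eq_comm
  simp [stdForm, aVec, bVec, Matrix.toBilin'_single, antiDiag, h]

/-- The flag with `i`-th step spanned by `a_1, …, a_i` and `b_n, …, b_{n+1-i}`. -/
def stdFlag (n : ℕ) (i : Fin (n + 1)) : Submodule ℂ (Std n) :=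
  Submodule.span ℂ (aVec '' {j : Fin n | (j : ℕ) < i} ∪ bVec '' {j : Fin n | n ≤ (j : ℕ) + i})

/-! ### Adding `ℂ^{2n}` -/

section Stabilization

variable {V : Type*} [AddCommGroup V] [Module ℂ V]

/-- The orthogonal direct sum of `V` and `ℂ^{2n}`. -/
def sumForm (B : LinearMap.BilinForm ℂ V) (ε : ℤˣ) (n : ℕ) : LinearMap.BilinForm ℂ (V × Std n) :=
  B.compl₁₂ (LinearMap.fst ℂ V (Std n)) (LinearMap.fst ℂ V (Std n)) +
    (stdForm ε n).compl₁₂ (LinearMap.snd ℂ V (Std n)) (LinearMap.snd ℂ V (Std n))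

/-- `x ↦ x ⊕ e_ε`. -/
def iNil (n : ℕ) (x : Module.End ℂ V) : Module.End ℂ (V × Std n) :=
  LinearMap.prodMap x (stdNilp n)

/-- `F ↦ F ⊕ F_ε`, step by step. -/
def iFlag {n : ℕ} (F : Fin (n + 1) → Submodule ℂ V) : Fin (n + 1) → Submodule ℂ (V × Std n) :=
  fun i => (F i).prod (stdFlag n i)

/-- `(x, F) ↦ (x ⊕ e_ε, F ⊕ F_ε)`. -/
def iM {n : ℕ} (m : Pt n V) : Pt n (V × Std n) := (iNil n m.1, iFlag m.2)

end Stabilization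

end Nilcone

end

namespace Nilcone

/-! ### Polynomial functions and affine maps -/

section PolyFun

variable {E E' : Type*} [AddCommGroup E] [Module ℂ E] [AddCommGroup E'] [Module ℂ E']

/-! All Jordan blocks of `e = e_ε` have size `n`, so its kernel and image filtrations coincide: `ker
e^i = im e^(n-i)`, and this space is the `i`-th step of `F_ε` (`ker_stdNilp_pow`,
`stdFlag_le_range`). Any flag `G` with `y(G_i) ⊆ G_(i-1)` satisfies `im y^(n-i) ⊆ G_i ⊆ ker y^i`.
For `y = x ⊕ e` the left inclusion puts `0 ⊕ F_ε,i` inside `G_i`, and the right one puts `G_i`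
inside `V ⊕ F_ε,i`. Hence `G_i = F_i ⊕ F_ε,i` with `F_i` the projection of `G_i` to `V`
(`iM_forgetStd`). Orthogonality, nilpotency and the lowering condition hold for the sum exactly when
they hold for the `V` part, since the standard summand satisfies its own share. This gives the
cartesian square and all the set-theoretic images.

For the variety structure it is enough to treat `iM` from an arbitrary set onto its image
(`isVarietyIso_iM`); each isomorphism claimed for `iM` then follows by computing an image. Both `iM`
and its inverse `forgetStd` lift, locally on frames, to affine maps, and polynomials pull back along
these (`isVarietyMorphism_of_lift`). An isometry acts linearly on frames, which handles conjugates.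
-/

theorem dual_mem_polyFun (l : Module.Dual ℂ E) : (fun e => l e) ∈ polyFun E :=
  Algebra.subset_adjoin ⟨l, rfl⟩

theorem const_mem_polyFun (c : ℂ) : (fun _ => c) ∈ polyFun E :=
  (polyFun E).algebraMap_mem c

/-- Polynomial functions pull back to polynomial functions along affine maps. -/
theorem comp_affine_mem_polyFun (L : E →ₗ[ℂ] E') (c : E') {p : E' → ℂ} (hp : p ∈ polyFun E') :
    (fun e => p (L e + c)) ∈ polyFun E := by
  induction hp using Algebra.adjoin_induction with
  | mem p hp =>
    obtain ⟨l, rfl⟩ := hp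
    have h := add_mem (dual_mem_polyFun (l ∘ₗ L)) (const_mem_polyFun (E := E) (l c))
    convert h using 1
    ext e
    simp
  | algebraMap r => exact (polyFun E).algebraMap_mem r
  | add p q _ _ hp hq => exact add_mem hp hq
  | mul p q _ _ hp hq => exact mul_mem hp hq

theorem prod_mem_polyFun {ι : Type*} (s : Finset ι) {q : ι → E → ℂ} (h : ∀ i, q i ∈ polyFun E) :
    (fun e => ∏ i ∈ s, q i e) ∈ polyFun E := by
  have := Subalgebra.prod_mem (polyFun E) (t := s) (f := q) fun i _ => h i
  convert this using 1
  ext e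
  simp

/-- Linear independence of a tuple of vectors depending linearly on a parameter is a Zariski open
condition. -/
theorem exists_polyFun_linearIndependent {k : ℕ} (w : E →ₗ[ℂ] (Fin k → E')) (a : E)
    (ha : LinearIndependent ℂ (w a)) :
    ∃ q ∈ polyFun E, q a ≠ 0 ∧ ∀ b, q b ≠ 0 → LinearIndependent ℂ (w b) := by
  classical
  -- `r` extends to all of `E'` the coordinate map of the independent tuple `w a`, so the
  -- determinant below is `1` at `a`; where it is nonzero, the images under `r` are independent,
  -- hence so are the vectors.
  obtain ⟨r, hr⟩ : ∃ r : E' →ₗ[ℂ] (Fin k → ℂ), ∀ j, r (w a j) = Pi.single j 1 := by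
    obtain ⟨r, hr⟩ := LinearMap.exists_extend
      ((Pi.basisFun ℂ (Fin k)).repr.symm.toLinearMap ∘ₗ
        (Finsupp.linearEquivFunOnFinite ℂ ℂ (Fin k)).symm.toLinearMap ∘ₗ
        (Finsupp.linearEquivFunOnFinite ℂ ℂ (Fin k)).toLinearMap ∘ₗ ha.repr)
    refine ⟨r, fun j => ?_⟩
    have h := LinearMap.congr_fun hr ⟨w a j, Submodule.subset_span ⟨j, rfl⟩⟩
    simp only [LinearMap.comp_apply, Submodule.subtype_apply, LinearEquiv.coe_coe] at h
    rw [h, ha.repr_eq_single j _ rfl]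
    simp
  let M : E → Matrix (Fin k) (Fin k) ℂ := fun b => Matrix.of fun i j => r (w b i) j
  refine ⟨fun b => (M b).det, ?_, ?_, fun b hb => ?_⟩
  · simp only [Matrix.det_apply']
    have : ∀ σ : Equiv.Perm (Fin k), (fun b => ((Equiv.Perm.sign σ : ℤ) : ℂ) *
        ∏ i, M b (σ i) i) ∈ polyFun E := fun σ =>
      mul_mem (const_mem_polyFun _) (prod_mem_polyFun _ fun i =>
        dual_mem_polyFun ((LinearMap.proj i : (Fin k → ℂ) →ₗ[ℂ] ℂ) ∘ₗ r ∘ₗ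
          (LinearMap.proj (σ i) : (Fin k → E') →ₗ[ℂ] E') ∘ₗ w))
    have h := Subalgebra.sum_mem (polyFun E) (t := Finset.univ) fun σ _ => this σ
    convert h using 1
    ext b
    simp
  · have : M a = 1 := by
      ext i j
      simp [M, hr, Matrix.one_apply, Pi.single_apply, eq_comm]
    simp [this]
  · have h := Matrix.linearIndependent_rows_of_det_ne_zero hb
    exact LinearIndependent.of_comp r h

end PolyFun

/-! ### Morphisms given by local affine lifts to frames -/

section Morphisms

variable {n : ℕ} {V : Type*} [AddCommGroup V] [Module ℂ V]
variable {V' : Type*} [AddCommGroup V'] [Module ℂ V']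
variable {V'' : Type*} [AddCommGroup V''] [Module ℂ V'']

/-- Local witnesses (`p`, `q`) for open sets and regular functions pull back along the affine lift.
Multiplying by the `q` of the lift confines them to the locus where the lift is valid, and this
factor cancels in quotients. -/
theorem isVarietyMorphism_of_lift {φ : Pt n V → Pt n V'} {Z : Set (Pt n V)} {Z' : Set (Pt n V')}
    (hφ : Set.MapsTo φ Z Z')
    (h : ∀ (D : Fin (n + 1) → ℕ) (a : PreFrame V D), IsFrame a → toPt a ∈ Z →
      ∃ (D' : Fin (n + 1) → ℕ) (L : PreFrame V D →ₗ[ℂ] PreFrame V' D') (c : PreFrame V' D'),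
        ∃ q ∈ polyFun (PreFrame V D), q a ≠ 0 ∧
          ∀ b : PreFrame V D, IsFrame b → toPt b ∈ Z → q b ≠ 0 →
            IsFrame (L b + c) ∧ toPt (L b + c) = φ (toPt b)) :
    IsVarietyMorphism φ Z Z' := by
  refine ⟨hφ, fun U' hU' => ⟨⟨Set.inter_subset_left, fun D a ha haU => ?_⟩,
    fun f hf D a ha haU => ?_⟩⟩
  · obtain ⟨D', L, c, q, hq, hqa, hL⟩ := h D a ha haU.1
    obtain ⟨h1, h2⟩ := hL a ha haU.1 hqa
    obtain ⟨q', hq', hqa', hU⟩ := hU'.2 D' _ h1 (h2 ▸ haU.2)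
    refine ⟨_, mul_mem hq (comp_affine_mem_polyFun L c hq'), mul_ne_zero hqa hqa',
      fun b hb hbZ hqb => ⟨hbZ, ?_⟩⟩
    obtain ⟨h3, h4⟩ := hL b hb hbZ (left_ne_zero_of_mul hqb)
    rw [Set.mem_preimage, ← h4]
    exact hU _ h3 (h4 ▸ hφ hbZ) (right_ne_zero_of_mul hqb)
  · obtain ⟨D', L, c, q, hq, hqa, hL⟩ := h D a ha haU.1
    obtain ⟨h1, h2⟩ := hL a ha haU.1 hqa
    obtain ⟨p', hp', q', hq', hqa', hU⟩ := hf D' _ h1 (h2 ▸ haU.2)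
    refine ⟨_, mul_mem hq (comp_affine_mem_polyFun L c hp'),
      _, mul_mem hq (comp_affine_mem_polyFun L c hq'), mul_ne_zero hqa hqa',
      fun b hb hbU hqb => ?_⟩
    obtain ⟨h3, h4⟩ := hL b hb hbU.1 (left_ne_zero_of_mul hqb)
    have h5 := hU _ h3 (h4 ▸ hbU.2) (right_ne_zero_of_mul hqb)
    rw [h4] at h5
    simp only [Function.comp_apply, Pi.mul_apply, h5]
    rw [mul_div_mul_left _ _ (left_ne_zero_of_mul hqb)]

theorem IsVarietyMorphism.comp {φ : Pt n V → Pt n V'} {φ' : Pt n V' → Pt n V''}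
    {Z : Set (Pt n V)} {Z' : Set (Pt n V')} {Z'' : Set (Pt n V'')}
    (h' : IsVarietyMorphism φ' Z' Z'') (h : IsVarietyMorphism φ Z Z') :
    IsVarietyMorphism (φ' ∘ φ) Z Z'' := by
  refine ⟨h'.1.comp h.1, fun U hU => ?_⟩
  obtain ⟨h1, h2⟩ := h'.2 U hU
  obtain ⟨h3, h4⟩ := h.2 _ h1
  have e : Z ∩ φ ⁻¹' (Z' ∩ φ' ⁻¹' U) = Z ∩ (φ' ∘ φ) ⁻¹' U := by
    ext m
    exact ⟨fun hm => ⟨hm.1, hm.2.2⟩, fun hm => ⟨hm.1, h.1 hm.1, hm.2⟩⟩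
  rw [e] at h3 h4
  exact ⟨h3, fun f hf => h4 _ (h2 f hf)⟩

theorem IsVarietyIso.comp {φ : Pt n V → Pt n V'} {φ' : Pt n V' → Pt n V''}
    {Z : Set (Pt n V)} {Z' : Set (Pt n V')} {Z'' : Set (Pt n V'')}
    (h' : IsVarietyIso φ' Z' Z'') (h : IsVarietyIso φ Z Z') :
    IsVarietyIso (φ' ∘ φ) Z Z'' := by
  obtain ⟨h1, ψ, h2, h3⟩ := h
  obtain ⟨h1', ψ', h2', h3'⟩ := h'
  exact ⟨h1'.comp h1, ψ ∘ ψ', h2.comp h2', h3.comp h3' h1.1 h2'.1⟩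

/-! ### Transport along a linear isomorphism -/

/-- The action of a linear isomorphism on pairs (endomorphism, subspaces). -/
def transport (g : V ≃ₗ[ℂ] V') (m : Pt n V) : Pt n V' :=
  (g.conj m.1, fun i => (m.2 i).map g.toLinearMap)

theorem transport_symm_transport (g : V ≃ₗ[ℂ] V') (m : Pt n V) :
    transport g.symm (transport g m) = m := by
  refine Prod.ext (by simp [transport]) (funext fun i => ?_)
  simp only [transport, ← Submodule.map_comp]
  simp

theorem isVarietyMorphism_transport (g : V ≃ₗ[ℂ] V') {Z : Set (Pt n V)} {Z' : Set (Pt n V')}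
    (h : Set.MapsTo (transport g) Z Z') : IsVarietyMorphism (transport g) Z Z' := by
  refine isVarietyMorphism_of_lift h fun D a _ _ => ⟨D,
    { toFun := fun b => (g.conj b.1, fun i j => g (b.2 i j))
      map_add' := fun b b' => by ext <;> simp
      map_smul' := fun r b => by ext <;> simp }, 0, 1, one_mem _, one_ne_zero, fun b hb _ _ => ?_⟩
  simp only [add_zero, LinearMap.coe_mk, AddHom.coe_mk]
  refine ⟨fun i => (hb i).map' g.toLinearMap g.ker, Prod.ext rfl (funext fun i => ?_)⟩
  simp only [toPt, transport, Submodule.map_span, ← Set.range_comp]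
  rfl

theorem isVarietyIso_transport (g : V ≃ₗ[ℂ] V') {Z : Set (Pt n V)} {Z' : Set (Pt n V')}
    (h : Set.MapsTo (transport g) Z Z') (h' : Set.MapsTo (transport g.symm) Z' Z) :
    IsVarietyIso (transport g) Z Z' :=
  ⟨isVarietyMorphism_transport g h, transport g.symm, isVarietyMorphism_transport g.symm h',
    fun m _ => transport_symm_transport g m, fun m _ => transport_symm_transport g.symm m⟩

/-! ### Adding a fixed summand -/

theorem isVarietyMorphism_iM {Z : Set (Pt n V)} {Z' : Set (Pt n (V × Std n))}
    (h : Set.MapsTo iM Z Z') : IsVarietyMorphism iM Z Z' := by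
  choose c _ hc hi using fun i : Fin (n + 1) =>
    Submodule.exists_fun_fin_finrank_span_eq ℂ (stdFlag n i : Set (Std n))
  simp only [Submodule.span_eq] at c hc hi
  -- The lift appends a fixed basis `c i` of `stdFlag n i` to each tuple: the given vectors form the
  -- linear part, while `c` and `stdNilp n` form the constant part. It is valid everywhere, so `q =
  -- 1`.
  refine isVarietyMorphism_of_lift h fun D a _ _ =>
    ⟨fun i => D i + Module.finrank ℂ (Submodule.span ℂ (stdFlag n i : Set (Std n))),
    { toFun := fun b => (LinearMap.prodMap b.1 0, fun i =>
        Sum.elim (fun j => (b.2 i j, 0)) (fun _ => 0) ∘ finSumFinEquiv.symm)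
      map_add' := fun b b' => by
        refine Prod.ext (by ext <;> simp) (funext fun i => funext fun j => ?_)
        rcases h : finSumFinEquiv.symm j <;> simp [h]
      map_smul' := fun r b => by
        refine Prod.ext (by ext <;> simp) (funext fun i => funext fun j => ?_)
        rcases h : finSumFinEquiv.symm j <;> simp [h] },
    (LinearMap.prodMap 0 (stdNilp n), fun i =>
      Sum.elim (fun _ => 0) (fun j => (0, c i j)) ∘ finSumFinEquiv.symm), 1, one_mem _, one_ne_zero,
      fun b hb _ _ => ?_⟩
  have key : ∀ i, (Sum.elim (fun j => (b.2 i j, (0 : Std n))) (fun _ => 0) ∘ finSumFinEquiv.symm +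
      Sum.elim (fun _ => 0) (fun j => ((0 : V), c i j)) ∘ finSumFinEquiv.symm :
      Fin (D i + _) → V × Std n) =
      Sum.elim (LinearMap.inl ℂ V (Std n) ∘ b.2 i) (LinearMap.inr ℂ V (Std n) ∘ c i) ∘
        finSumFinEquiv.symm := by
    intro i
    funext j
    rcases h : finSumFinEquiv.symm j <;> simp [h]
  refine ⟨fun i => ?_, Prod.ext ?_ (funext fun i => ?_)⟩
  · have h := (linearIndependent_inl_union_inr' (hb i) (hi i)).comp _
      (finSumFinEquiv.symm : Fin (D i + _) ≃ _).injective
    rwa [← key i] at h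
  · refine LinearMap.ext fun v => Prod.ext ?_ ?_ <;> simp [toPt, iM, iNil]
  · refine (congrArg (fun f => Submodule.span ℂ (Set.range f)) (key i)).trans ?_
    rw [Set.range_comp, Equiv.range_eq_univ, Set.image_univ, Set.Sum.elim_range, Set.range_comp,
      Set.range_comp, LinearMap.span_inl_union_inr, hc]
    rfl

/-- The map that forgets the second summand. -/
def forgetStd (m : Pt n (V × Std n)) : Pt n V :=
  (LinearMap.fst ℂ V (Std n) ∘ₗ m.1 ∘ₗ LinearMap.inl ℂ V (Std n),
    fun i => (m.2 i).map (LinearMap.fst ℂ V (Std n)))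

theorem forgetStd_iM (m : Pt n V) : forgetStd (iM m) = m := by
  refine Prod.ext (by ext; simp [forgetStd, iM, iNil]) (funext fun i => ?_)
  ext v
  simp only [forgetStd, iM, iFlag, Submodule.mem_map, Submodule.mem_prod, LinearMap.fst_apply]
  exact ⟨fun ⟨w, hw, e⟩ => e ▸ hw.1, fun hv => ⟨(v, 0), ⟨hv, zero_mem _⟩, rfl⟩⟩

theorem finrank_submodule_prod [FiniteDimensional ℂ V] [FiniteDimensional ℂ V']
    (p : Submodule ℂ V) (q : Submodule ℂ V') :
    Module.finrank ℂ (p.prod q) = Module.finrank ℂ p + Module.finrank ℂ q := by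
  rw [← Module.finrank_prod]
  exact LinearEquiv.finrank_eq
    { toFun := fun v => (⟨v.1.1, v.2.1⟩, ⟨v.1.2, v.2.2⟩)
      map_add' := fun _ _ => rfl
      map_smul' := fun _ _ => rfl
      invFun := fun v => ⟨(v.1.1, v.2.1), v.1.2, v.2.2⟩ }

/-- The projected frame vectors span the projected step but are dependent in general. A subtuple
that is a basis at `a` stays independent on an open set, and it stays spanning because the dimension
of the projected step is determined by `D`. -/
theorem isVarietyMorphism_forgetStd [FiniteDimensional ℂ V] (Z : Set (Pt n V)) :
    IsVarietyMorphism forgetStd (iM '' Z) Z := by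
  refine isVarietyMorphism_of_lift ?_ fun D a ha haZ => ?_
  · rintro _ ⟨m, hm, rfl⟩
    rwa [forgetStd_iM]
  -- Being in the image of `iM` is what forces this constant dimension.
  have hfin : ∀ b : PreFrame (V × Std n) D, IsFrame b → toPt b ∈ iM '' Z → ∀ i,
      D i = Module.finrank ℂ ((forgetStd (toPt b)).2 i) + Module.finrank ℂ (stdFlag n i) := by
    rintro b hb ⟨m, -, hm⟩ i
    rw [← hm, forgetStd_iM, ← finrank_submodule_prod]
    have := finrank_span_eq_card (hb i)
    rw [Fintype.card_fin] at this
    rw [← this]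
    exact congrArg (fun F : Pt n (V × Std n) => Module.finrank ℂ (F.2 i)) hm.symm
  have hspan : ∀ (b : PreFrame (V × Std n) D) i, (forgetStd (toPt b)).2 i =
      Submodule.span ℂ (Set.range fun j => (b.2 i j).1) := by
    intro b i
    simp only [forgetStd, toPt, Submodule.map_span, ← Set.range_comp]
    rfl
  choose c hcm hc hi using fun i : Fin (n + 1) =>
    -- The indices `σ` chosen at `a` are kept for all nearby `b`, so that the lift `L` is linear.
    Submodule.exists_fun_fin_finrank_span_eq ℂ (Set.range fun j => (a.2 i j).1)
  choose σ hσ using hcm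
  let D' : Fin (n + 1) → ℕ := fun i =>
    Module.finrank ℂ (Submodule.span ℂ (Set.range fun j => (a.2 i j).1))
  let L : PreFrame (V × Std n) D →ₗ[ℂ] PreFrame V D' :=
    { toFun := fun b => (LinearMap.fst ℂ V (Std n) ∘ₗ b.1 ∘ₗ LinearMap.inl ℂ V (Std n),
        fun i j => (b.2 i (σ i j)).1)
      map_add' := fun b b' => by ext <;> simp
      map_smul' := fun r b => by ext <;> simp }
  have hq : ∀ i, ∃ q ∈ polyFun (PreFrame (V × Std n) D), q a ≠ 0 ∧ ∀ b, q b ≠ 0 →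
      LinearIndependent ℂ ((L b).2 i) := by
    intro i
    refine exists_polyFun_linearIndependent
      (LinearMap.proj i ∘ₗ LinearMap.snd ℂ (Module.End ℂ V) _ ∘ₗ L) a ?_
    have h : (fun j => (a.2 i (σ i j)).1) = c i := funext (hσ i)
    change LinearIndependent ℂ fun j => (a.2 i (σ i j)).1
    rw [h]
    exact hi i
  choose q hqp hqa hqi using hq
  refine ⟨D', L, 0, _, prod_mem_polyFun Finset.univ hqp,
    Finset.prod_ne_zero_iff.2 fun i _ => hqa i, fun b hb hbZ hqb => ?_⟩
  rw [add_zero]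
  have hLb : ∀ i, LinearIndependent ℂ ((L b).2 i) := fun i =>
    hqi i b (Finset.prod_ne_zero_iff.1 hqb i (Finset.mem_univ i))
  refine ⟨hLb, Prod.ext rfl (funext fun i => ?_)⟩
  rw [hspan]
  refine Submodule.eq_of_le_of_finrank_eq (Submodule.span_mono ?_) ?_
  · rintro _ ⟨j, rfl⟩
    exact ⟨σ i j, rfl⟩
  · have h1 := hfin b hb hbZ i
    have h2 := hfin a ha haZ i
    rw [hspan] at h1 h2
    have h3 := finrank_span_eq_card (hLb i)
    rw [Fintype.card_fin] at h3
    refine h3.trans ?_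
    simp only [D']
    omega

theorem isVarietyIso_iM [FiniteDimensional ℂ V] (Z : Set (Pt n V)) :
    IsVarietyIso iM Z (iM '' Z) :=
  ⟨isVarietyMorphism_iM (Set.mapsTo_image _ _), forgetStd, isVarietyMorphism_forgetStd Z,
    fun m _ => forgetStd_iM m, by rintro _ ⟨m, _, rfl⟩; rw [forgetStd_iM]⟩

end Morphisms

/-! ### The standard nilpotent element, flag and form in coordinates -/

section Std

variable {n : ℕ}

theorem stdForm_apply (ε : ℤˣ) (u w : Std n) :
    stdForm ε n u w = ∑ j : Fin n, u (Sum.inl j) * w (Sum.inr j.rev) +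
      ((ε : ℤ) : ℂ) * ∑ j : Fin n, u (Sum.inr j) * w (Sum.inl j.rev) := by
  simp [stdForm, Matrix.toBilin'_apply, antiDiag, Finset.mul_sum, mul_left_comm, mul_assoc]

theorem jordanBlock_mulVec (w : Fin n → ℂ) (j : Fin n) :
    (jordanBlock n).mulVec w j = if h : (j : ℕ) + 1 < n then w ⟨j + 1, h⟩ else 0 := by
  simp only [Matrix.mulVec, dotProduct, jordanBlock, Matrix.of_apply, ite_mul, one_mul, zero_mul]
  split_ifs with h
  · rw [Finset.sum_eq_single ⟨j + 1, h⟩]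
    · simp
    · intro k _ hk
      rw [if_neg]
      exact fun e => hk (Fin.ext e.symm)
    · simp
  · refine Finset.sum_eq_zero fun k _ => if_neg ?_
    have := k.isLt
    omega

theorem stdNilp_apply (w : Std n) :
    stdNilp n w = Sum.elim ((jordanBlock n).mulVec (w ∘ Sum.inl))
      (-(jordanBlock n).mulVec (w ∘ Sum.inr)) := by
  simp [stdNilp, Matrix.toLin'_apply, Matrix.fromBlocks_mulVec, Matrix.neg_mulVec]

theorem stdNilp_inl (w : Std n) (j : Fin n) :
    stdNilp n w (Sum.inl j) = if h : (j : ℕ) + 1 < n then w (Sum.inl ⟨j + 1, h⟩) else 0 := by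
  simp [stdNilp_apply, jordanBlock_mulVec]

theorem stdNilp_inr (w : Std n) (j : Fin n) :
    stdNilp n w (Sum.inr j) = if h : (j : ℕ) + 1 < n then -w (Sum.inr ⟨j + 1, h⟩) else 0 := by
  simp only [stdNilp_apply, Sum.elim_inr, Pi.neg_apply, jordanBlock_mulVec]
  split_ifs <;> simp

theorem stdNilp_pow_inl (k : ℕ) (w : Std n) (j : Fin n) :
    (stdNilp n ^ k) w (Sum.inl j) =
      if h : (j : ℕ) + k < n then w (Sum.inl ⟨j + k, h⟩) else 0 := by
  induction k generalizing w with
  | zero => simp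
  | succ k ih =>
    rw [pow_succ, Module.End.mul_apply, ih]
    by_cases h : (j : ℕ) + (k + 1) < n
    · have h' : (j : ℕ) + k < n := by omega
      rw [dif_pos h, dif_pos h', stdNilp_inl, dif_pos (show (j : ℕ) + k + 1 < n by omega)]
      rfl
    · rw [dif_neg h]
      split_ifs with h'
      · rw [stdNilp_inl, dif_neg]
        simpa [add_assoc] using h
      · rfl

theorem stdNilp_pow_inr (k : ℕ) (w : Std n) (j : Fin n) :
    (stdNilp n ^ k) w (Sum.inr j) =
      if h : (j : ℕ) + k < n then (-1) ^ k * w (Sum.inr ⟨j + k, h⟩) else 0 := by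
  induction k generalizing w with
  | zero => simp
  | succ k ih =>
    rw [pow_succ, Module.End.mul_apply, ih]
    by_cases h : (j : ℕ) + (k + 1) < n
    · have h' : (j : ℕ) + k < n := by omega
      rw [dif_pos h, dif_pos h', stdNilp_inr, dif_pos (show (j : ℕ) + k + 1 < n by omega)]
      rw [pow_succ, mul_neg, mul_neg_one, neg_mul]
      rfl
    · rw [dif_neg h]
      split_ifs with h'
      · rw [stdNilp_inr, dif_neg, mul_zero]
        simpa [add_assoc] using h
      · rfl

/-- `bVec` reverses indices, so `b_n, …, b_{n+1-i}` are the first `i` coordinate vectors of the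
second block, and the step is a coordinate subspace. -/
theorem mem_stdFlag {i : Fin (n + 1)} {w : Std n} :
    w ∈ stdFlag n i ↔ ∀ j : Fin n, (i : ℕ) ≤ j → w (Sum.inl j) = 0 ∧ w (Sum.inr j) = 0 := by
  constructor
  · intro hw
    induction hw using Submodule.span_induction with
    | mem w hw =>
      intro j hj
      rcases hw with ⟨k, hk, rfl⟩ | ⟨k, hk, rfl⟩
      · have : j ≠ k := by rintro rfl; exact absurd hk (not_lt.2 hj)
        simp [aVec, this]
      · have : j ≠ k.rev := by
          rintro rfl
          simp only [Set.mem_ofPred_eq, Fin.val_rev] at hk hj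
          omega
        simp [bVec, this]
    | zero => simp
    | add w w' _ _ h h' =>
      intro j hj
      simp [h j hj, h' j hj]
    | smul r w _ h =>
      intro j hj
      simp [h j hj]
  · intro h
    have hw : w = ∑ j, w (Sum.inl j) • aVec j + ∑ j, w (Sum.inr j) • bVec j.rev := by
      have := pi_eq_sum_univ' w
      rw [Fintype.sum_sum_type] at this
      convert this using 4 with j _ j _
      · ext k
        simp [aVec, Pi.single_apply]
      · ext k
        simp [bVec, Pi.single_apply]
    rw [hw]
    refine add_mem (sum_mem fun j _ => ?_) (sum_mem fun j _ => ?_)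
    · by_cases hj : (i : ℕ) ≤ j
      · simp [(h j hj).1]
      · exact Submodule.smul_mem _ _ (Submodule.subset_span (Or.inl ⟨j, not_le.1 hj, rfl⟩))
    · by_cases hj : (i : ℕ) ≤ j
      · simp [(h j hj).2]
      · refine Submodule.smul_mem _ _ (Submodule.subset_span (Or.inr ⟨j.rev, ?_, rfl⟩))
        simp only [Set.mem_ofPred_eq, Fin.val_rev]
        omega

theorem ker_stdNilp_pow (i : Fin (n + 1)) : LinearMap.ker (stdNilp n ^ (i : ℕ)) = stdFlag n i := by
  ext w
  rw [LinearMap.mem_ker, mem_stdFlag]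
  constructor
  · intro h j hj
    have hj' : (j : ℕ) - i < n := by omega
    have e : (⟨(j : ℕ) - i + i, by omega⟩ : Fin n) = j := Fin.ext (by simp; omega)
    have h1 := congrFun h (Sum.inl ⟨j - i, hj'⟩)
    have h2 := congrFun h (Sum.inr ⟨j - i, hj'⟩)
    rw [stdNilp_pow_inl, dif_pos (show (j : ℕ) - i + i < n by omega)] at h1
    rw [stdNilp_pow_inr, dif_pos (show (j : ℕ) - i + i < n by omega)] at h2
    simp only [e] at h1 h2
    exact ⟨h1, by simpa using h2⟩
  · intro h
    ext (j | j)
    · rw [stdNilp_pow_inl]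
      split_ifs with hj
      · exact (h _ (by simp)).1
      · rfl
    · rw [stdNilp_pow_inr]
      split_ifs with hj
      · rw [(h _ (by simp)).2]
        simp
      · rfl

theorem stdNilp_pow_self : stdNilp n ^ n = 0 := by
  refine LinearMap.ext fun w => ?_
  ext (j | j)
  · simp [stdNilp_pow_inl]
  · simp [stdNilp_pow_inr]

theorem stdFlag_le_range (i : Fin (n + 1)) :
    stdFlag n i ≤ LinearMap.range (stdNilp n ^ (i.rev : ℕ)) := by
  intro w hw
  rw [mem_stdFlag] at hw
  -- The preimage shifts the coordinates up by `n - i`; the sign in the second block cancels the one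
  -- produced by the power.
  refine ⟨Sum.elim
    (fun j => if h : (i.rev : ℕ) ≤ j then w (Sum.inl ⟨j - i.rev, by omega⟩) else 0)
    (fun j => if h : (i.rev : ℕ) ≤ j then
      (-1) ^ (i.rev : ℕ) * w (Sum.inr ⟨j - i.rev, by omega⟩) else 0), ?_⟩
  have hi := i.val_rev
  ext (j | j)
  · rw [stdNilp_pow_inl]
    split_ifs with h
    · rw [Sum.elim_inl, dif_pos (Nat.le_add_left _ _)]
      simp only [Nat.add_sub_cancel]
    · exact (hw j (by omega)).1.symm
  · rw [stdNilp_pow_inr]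
    split_ifs with h
    · rw [Sum.elim_inr, dif_pos (Nat.le_add_left _ _), ← mul_assoc, ← mul_pow]
      simp only [Nat.add_sub_cancel, neg_mul_neg, one_mul, one_pow]
    · exact (hw j (by omega)).2.symm

theorem finrank_stdFlag (i : Fin (n + 1)) : Module.finrank ℂ (stdFlag n i) = 2 * i := by
  have hi : (i : ℕ) ≤ n := Nat.le_of_lt_succ i.isLt
  let f : Fin i ⊕ Fin i → Std n :=
    fun k => Pi.basisFun ℂ _ (Sum.map (Fin.castLE hi) (Fin.castLE hi) k)
  have hf : LinearIndependent ℂ f := (Pi.basisFun ℂ (Fin n ⊕ Fin n)).linearIndependent.comp _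
    (Sum.map_injective.2 ⟨Fin.castLE_injective hi, Fin.castLE_injective hi⟩)
  have h : stdFlag n i = Submodule.span ℂ (Set.range f) := by
    refine le_antisymm (Submodule.span_le.2 ?_) (Submodule.span_le.2 ?_)
    · rintro _ (⟨k, hk, rfl⟩ | ⟨k, hk, rfl⟩)
      · refine Submodule.subset_span ⟨Sum.inl ⟨k, hk⟩, ?_⟩
        simp [f, aVec]
      · have hk' : (k.rev : ℕ) < i := by
          simp only [Set.mem_ofPred_eq] at hk
          rw [Fin.val_rev]
          omega
        refine Submodule.subset_span ⟨Sum.inr ⟨k.rev, hk'⟩, ?_⟩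
        simp only [f, Pi.basisFun_apply, Sum.map_inr, bVec]
        rfl
    · rintro _ ⟨k | k, rfl⟩
      · refine mem_stdFlag.2 fun j hj => ?_
        have : j ≠ Fin.castLE hi k := by
          rintro rfl
          simp at hj
          omega
        simp [f, this]
      · refine mem_stdFlag.2 fun j hj => ?_
        have : j ≠ Fin.castLE hi k := by
          rintro rfl
          simp at hj
          omega
        simp [f, this]
  rw [h, finrank_span_eq_card hf]
  simp
  omega

theorem finrank_ker_stdNilp_pow (k : ℕ) :
    Module.finrank ℂ (LinearMap.ker (stdNilp n ^ k)) = 2 * min k n := by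
  rcases le_total k n with h | h
  · rw [min_eq_left h]
    have := finrank_stdFlag (n := n) ⟨k, by omega⟩
    rwa [← ker_stdNilp_pow] at this
  · rw [min_eq_right h, pow_eq_zero_of_le h stdNilp_pow_self, LinearMap.ker_zero, finrank_top]
    simp
    omega

/-- The form pairs coordinate `j` of one block with coordinate `n - 1 - j` of the other, so
vanishing against the first `i` coordinates kills those of index at least `n - i`. -/
theorem orthogonal_stdFlag (ε : ℤˣ) (i : Fin (n + 1)) :
    (stdForm ε n).orthogonal (stdFlag n i) = stdFlag n i.rev := by
  have hi := i.val_rev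
  ext w
  rw [LinearMap.BilinForm.mem_orthogonal_iff, mem_stdFlag]
  constructor
  · intro h j hj
    have hj' : (j.rev : ℕ) < i := by
      rw [Fin.val_rev]
      omega
    have h1 := h (Pi.single (Sum.inl j.rev) 1) (mem_stdFlag.2 fun k hk => by
      have : k ≠ j.rev := by rintro rfl; omega
      simp [this])
    have h2 := h (Pi.single (Sum.inr j.rev) 1) (mem_stdFlag.2 fun k hk => by
      have : k ≠ j.rev := by rintro rfl; omega
      simp [this])
    rw [stdForm_apply] at h1 h2
    simp [Pi.single_apply] at h1 h2
    exact ⟨h2, h1⟩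
  · intro h u hu
    rw [mem_stdFlag] at hu
    have key : ∀ j : Fin n, u (Sum.inl j) * w (Sum.inr j.rev) = 0 ∧
        u (Sum.inr j) * w (Sum.inl j.rev) = 0 := by
      intro j
      by_cases hj : (i : ℕ) ≤ j
      · simp [hu j hj]
      · have := h j.rev (by rw [Fin.val_rev j]; omega)
        simp [this]
    rw [stdForm_apply, Finset.sum_eq_zero fun j _ => (key j).1,
      Finset.sum_eq_zero fun j _ => (key j).2]
    simp

theorem units_mul_self (ε : ℤˣ) : ((ε : ℤ) : ℂ) * ((ε : ℤ) : ℂ) = 1 := by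
  rcases Int.units_eq_one_or ε with rfl | rfl <;> simp

theorem stdForm_symm (ε : ℤˣ) (u w : Std n) :
    stdForm ε n u w = ((ε : ℤ) : ℂ) * stdForm ε n w u := by
  rw [stdForm_apply, stdForm_apply, mul_add, ← mul_assoc, units_mul_self, one_mul, add_comm]
  congr 1
  · congr 1
    exact Fintype.sum_equiv Fin.revPerm _ _ fun j => by simp [mul_comm]
  · exact Fintype.sum_equiv Fin.revPerm _ _ fun j => by simp [mul_comm]

theorem IsEpsForm.of_separatingRight {V : Type*} [AddCommGroup V] [Module ℂ V] {ε : ℤˣ}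
    {B : LinearMap.BilinForm ℂ V} (h : ∀ w, (∀ u, B u w = 0) → w = 0)
    (hs : ∀ u w, B u w = ((ε : ℤ) : ℂ) * B w u) : IsEpsForm ε B :=
  ⟨⟨fun u hu => h u fun w => by rw [hs, hu, mul_zero], h⟩, hs⟩

theorem isEpsForm_stdForm (ε : ℤˣ) (n : ℕ) : IsEpsForm ε (stdForm ε n) := by
  refine IsEpsForm.of_separatingRight (fun w hw => ?_) (stdForm_symm ε)
  -- The radical is the orthogonal of the last step, hence the zeroth step.
  have h : w ∈ (stdForm ε n).orthogonal (stdFlag n (Fin.last n)) :=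
    LinearMap.BilinForm.mem_orthogonal_iff.2 fun u _ => hw u
  rw [orthogonal_stdFlag, mem_stdFlag] at h
  ext (j | j)
  · exact (h j (by simp)).1
  · exact (h j (by simp)).2

theorem stdFlag_zero : stdFlag n 0 = ⊥ := by
  rw [← ker_stdNilp_pow]
  exact LinearMap.ker_id

theorem stdFlag_last : stdFlag n (Fin.last n) = ⊤ := by
  rw [← ker_stdNilp_pow, Fin.val_last, stdNilp_pow_self, LinearMap.ker_zero]

theorem stdFlag_mono : Monotone (stdFlag n) := fun _ _ hij _ hw =>
  mem_stdFlag.2 fun k hk => mem_stdFlag.1 hw k (le_trans hij hk)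

theorem stdNilp_skew (ε : ℤˣ) (u w : Std n) :
    stdForm ε n (stdNilp n u) w = - stdForm ε n u (stdNilp n w) := by
  -- The Jordan block is symmetric about the antidiagonal, hence self-adjoint for the antidiagonal
  -- pairing; the opposite signs on the two blocks make `stdNilp` skew.
  have key : ∀ p q : Fin n → ℂ, ∑ j : Fin n, (jordanBlock n).mulVec p j * q j.rev =
      ∑ j : Fin n, p j * (jordanBlock n).mulVec q j.rev := by
    intro p q
    simp only [Matrix.mulVec, dotProduct, Finset.sum_mul, Finset.mul_sum]
    rw [Finset.sum_comm]
    refine Finset.sum_congr rfl fun k _ => Fintype.sum_equiv Fin.revPerm _ _ fun j => ?_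
    have h : jordanBlock n k.rev j.rev = jordanBlock n j k := by
      simp only [jordanBlock, Matrix.of_apply, Fin.val_rev]
      congr 1
      exact propext (by omega)
    rw [Fin.revPerm_apply, h]
    ring
  rw [stdForm_apply, stdForm_apply]
  simp only [stdNilp_apply, Sum.elim_inl, Sum.elim_inr, Pi.neg_apply, neg_mul, mul_neg,
    Finset.sum_neg_distrib]
  rw [key (u ∘ Sum.inl) fun j => w (Sum.inr j), key (u ∘ Sum.inr) fun j => w (Sum.inl j)]
  simp only [Function.comp_def]
  ring

end Std

/-! ### Comparison of flags in `V` and in `V ⊕ ℂ^{2n}` -/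

section Sum

variable {V : Type*} [AddCommGroup V] [Module ℂ V] {n : ℕ} {ε : ℤˣ} {B : LinearMap.BilinForm ℂ V}

theorem prod_le_prod_iff {W : Type*} [AddCommGroup W] [Module ℂ W] {p p' : Submodule ℂ V}
    {q q' : Submodule ℂ W} : p.prod q ≤ p'.prod q' ↔ p ≤ p' ∧ q ≤ q' := by
  refine ⟨fun h => ⟨fun v hv => ?_, fun w hw => ?_⟩, fun h => Submodule.prod_mono h.1 h.2⟩
  · exact (h (⟨hv, zero_mem _⟩ : (v, (0 : W)) ∈ p.prod q)).1
  · exact (h (⟨zero_mem _, hw⟩ : ((0 : V), w) ∈ p.prod q)).2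

theorem prod_right_inj {W : Type*} [AddCommGroup W] [Module ℂ W] {p p' : Submodule ℂ V}
    {q : Submodule ℂ W} : p.prod q = p'.prod q ↔ p = p' := by
  simp [le_antisymm_iff, prod_le_prod_iff]

theorem sumForm_apply (u w : V × Std n) :
    sumForm B ε n u w = B u.1 w.1 + stdForm ε n u.2 w.2 := rfl

theorem isEpsForm_sumForm (hB : IsEpsForm ε B) : IsEpsForm ε (sumForm B ε n) := by
  refine IsEpsForm.of_separatingRight (fun w hw => Prod.ext ?_ ?_) fun u w => ?_
  · refine hB.1.2 _ fun u => ?_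
    simpa [sumForm_apply] using hw (u, 0)
  · refine (isEpsForm_stdForm ε n).1.2 _ fun u => ?_
    simpa [sumForm_apply] using hw (0, u)
  · rw [sumForm_apply, sumForm_apply, hB.2, stdForm_symm, mul_add]

theorem iNil_pow (x : Module.End ℂ V) (k : ℕ) :
    iNil n x ^ k = LinearMap.prodMap (x ^ k) (stdNilp n ^ k) := by
  induction k with
  | zero => rfl
  | succ k ih => rw [pow_succ, ih, iNil, LinearMap.prodMap_mul, pow_succ, pow_succ]

theorem mem_nilcone_iff {W : Type*} [AddCommGroup W] [Module ℂ W] {B : LinearMap.BilinForm ℂ W}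
    {x : Module.End ℂ W} :
    x ∈ nilcone B n ↔ (∀ u w, B (x u) w = - B u (x w)) ∧ x ^ n = 0 := by
  have : x ∈ skewAdjointLieSubalgebra B ↔ ∀ u w, B (x u) w = - B u (x w) := by
    refine (LinearMap.mem_skewAdjointSubmodule (B := B) x).trans ?_
    simp [LinearMap.IsSkewAdjoint, LinearMap.IsAdjointPair]
  rw [← this]
  exact ⟨fun h => ⟨h.1, h.2.2⟩, fun h => ⟨h.1, ⟨n, h.2⟩, h.2⟩⟩

theorem iNil_mem_nilcone_iff {x : Module.End ℂ V} :
    iNil n x ∈ nilcone (sumForm B ε n) n ↔ x ∈ nilcone B n := by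
  rw [mem_nilcone_iff, mem_nilcone_iff, iNil_pow, stdNilp_pow_self]
  refine and_congr ⟨fun h u w => ?_, fun h u w => ?_⟩ ⟨fun h => ?_, fun h => ?_⟩
  · simpa [sumForm_apply, iNil] using h (u, 0) (w, 0)
  · simp only [sumForm_apply, iNil, LinearMap.prodMap_apply, h, stdNilp_skew]
    ring
  · ext v
    simpa using congrArg Prod.fst (LinearMap.congr_fun h (v, 0))
  · rw [h]
    rfl

theorem iNil_injective : Function.Injective (iNil n : Module.End ℂ V → _) := fun x y h => by
  ext v
  simpa [iNil] using congrArg Prod.fst (LinearMap.congr_fun h (v, 0))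

theorem orthogonal_sumForm_prod (p : Submodule ℂ V) (q : Submodule ℂ (Std n)) :
    (sumForm B ε n).orthogonal (p.prod q) =
      (B.orthogonal p).prod ((stdForm ε n).orthogonal q) := by
  ext w
  simp only [LinearMap.BilinForm.mem_orthogonal_iff, Submodule.mem_prod, sumForm_apply]
  refine ⟨fun h => ⟨fun u hu => ?_, fun u hu => ?_⟩, fun h u hu => ?_⟩
  · simpa using h (u, 0) ⟨hu, zero_mem _⟩
  · simpa using h (0, u) ⟨zero_mem _, hu⟩
  · rw [h.1 _ hu.1, h.2 _ hu.2, add_zero]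

theorem iFlag_mem_isotropicFlags_iff {F : Fin (n + 1) → Submodule ℂ V} :
    iFlag F ∈ isotropicFlags (sumForm B ε n) n ↔ F ∈ isotropicFlags B n := by
  refine and_congr ?_ (and_congr ?_ (and_congr ?_ (forall_congr' fun i => ?_)))
  · rw [iFlag, stdFlag_zero, ← Submodule.prod_bot, prod_right_inj]
  · rw [iFlag, stdFlag_last, ← Submodule.prod_top, prod_right_inj]
  · exact ⟨fun h i j hij => (prod_le_prod_iff.1 (h hij)).1,
      fun h i j hij => prod_le_prod_iff.2 ⟨h hij, stdFlag_mono hij⟩⟩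
  · rw [iFlag, iFlag, orthogonal_sumForm_prod, orthogonal_stdFlag, prod_right_inj]

theorem map_stdFlag_succ_le (i : Fin n) :
    (stdFlag n i.succ).map (stdNilp n) ≤ stdFlag n i.castSucc := by
  rintro _ ⟨w, hw, rfl⟩
  rw [SetLike.mem_coe, ← ker_stdNilp_pow, LinearMap.mem_ker] at hw
  rwa [← ker_stdNilp_pow, LinearMap.mem_ker, ← Module.End.mul_apply, ← pow_succ]

/-- The reverse implication shows that `iM` is well defined; the forward one shows that the `V` part
of a split flag is again a point of the cotangent bundle. -/
theorem iM_mem_cotangentFlags_iff {m : Pt n V} :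
    iM m ∈ cotangentFlags (sumForm B ε n) n ↔ m ∈ cotangentFlags B n := by
  refine and_congr iNil_mem_nilcone_iff
    (and_congr iFlag_mem_isotropicFlags_iff (forall_congr' fun i => ?_))
  simp only [iM, iFlag, Submodule.map_le_iff_le_comap, iNil, LinearMap.prodMap_comap_prod,
    prod_le_prod_iff]
  exact and_iff_left (Submodule.map_le_iff_le_comap.1 (map_stdFlag_succ_le i))

theorem iM_injective : Function.Injective (iM : Pt n V → Pt n (V × Std n)) := fun m m' h => by
  rw [← forgetStd_iM m, h, forgetStd_iM]

section Flags

variable {W : Type*} [AddCommGroup W] [Module ℂ W] {m : Pt n W}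

/-- Each application lowers the step by one, so `i` of them reach `F_0 = 0`. -/
theorem flag_le_ker_pow (h0 : m.2 0 = ⊥)
    (h : ∀ i : Fin n, (m.2 i.succ).map m.1 ≤ m.2 i.castSucc) (i : Fin (n + 1)) :
    m.2 i ≤ LinearMap.ker (m.1 ^ (i : ℕ)) := by
  induction i using Fin.induction with
  | zero => rw [h0]; exact bot_le
  | succ i ih =>
    intro w hw
    rw [LinearMap.mem_ker, Fin.val_succ, pow_succ, Module.End.mul_apply]
    exact ih (h i ⟨w, hw, rfl⟩)

/-- Starting from `F_n`, the whole space, `n - i` applications land in `F_i`. -/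
theorem range_pow_le_flag (h1 : m.2 (Fin.last n) = ⊤)
    (h : ∀ i : Fin n, (m.2 i.succ).map m.1 ≤ m.2 i.castSucc) (i : Fin (n + 1)) :
    LinearMap.range (m.1 ^ (i.rev : ℕ)) ≤ m.2 i := by
  induction i using Fin.reverseInduction with
  | last => rw [h1]; exact le_top
  | cast i ih =>
    rintro _ ⟨w, rfl⟩
    rw [Fin.rev_castSucc, Fin.val_succ, pow_succ', Module.End.mul_apply]
    refine h i ⟨_, ih ⟨w, ?_⟩, rfl⟩
    rw [Fin.rev_succ, Fin.val_castSucc]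

end Flags

/-- A flag compatible with `x ⊕ e_ε` lies between `0 ⊕ F_ε` and `V ⊕ F_ε`, so it splits. -/
theorem iM_forgetStd {x : Module.End ℂ V} {m : Pt n (V × Std n)} (hm : m.1 = iNil n x)
    (h0 : m.2 0 = ⊥) (h1 : m.2 (Fin.last n) = ⊤)
    (h : ∀ i : Fin n, (m.2 i.succ).map m.1 ≤ m.2 i.castSucc) :
    iM (forgetStd m) = m := by
  have hker : ∀ i, ∀ w ∈ m.2 i, w.2 ∈ stdFlag n i := by
    intro i w hw
    have := flag_le_ker_pow h0 h i hw
    rw [hm, iNil_pow, LinearMap.ker_prodMap, ker_stdNilp_pow] at this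
    exact this.2
  have hrange : ∀ i, ∀ w ∈ stdFlag n i, ((0 : V), w) ∈ m.2 i := by
    intro i w hw
    obtain ⟨u, rfl⟩ := stdFlag_le_range i hw
    refine range_pow_le_flag h1 h i ⟨(0, u), ?_⟩
    rw [hm, iNil_pow]
    simp
  refine Prod.ext ?_ (funext fun i => ?_)
  · rw [hm]
    simp only [iM, forgetStd, hm]
    congr 1
  · ext ⟨v, w⟩
    constructor
    · rintro ⟨⟨⟨v', w'⟩, hv, rfl⟩, hw⟩
      -- Both `w` and `w'` lie in `stdFlag n i`, so adding `(0, w - w')`, which is in the flag step,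
      -- moves `(v', w')` to `(v', w)`.
      have := add_mem hv (hrange i _ (sub_mem hw (hker i _ hv)))
      simpa using this
    · exact fun hvw => ⟨⟨_, hvw, rfl⟩, hker i _ hvw⟩

theorem exists_iM_eq {x : Module.End ℂ V} {m' : Pt n (V × Std n)}
    (hm' : m' ∈ cotangentFlags (sumForm B ε n) n) (hx : proj m' = iNil n x) :
    ∃ m ∈ fiber B n x, iM m = m' := by
  have e : iM (forgetStd m') = m' := iM_forgetStd hx hm'.2.1.1 hm'.2.1.2.1 hm'.2.2
  exact ⟨forgetStd m', ⟨iM_mem_cotangentFlags_iff.1 (by rwa [e]),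
    iNil_injective (n := n) ((congrArg Prod.fst e).trans hx)⟩, e⟩

theorem image_iM_fiber (x : Module.End ℂ V) :
    iM '' fiber B n x = fiber (sumForm B ε n) n (iNil n x) := by
  ext m'
  constructor
  · rintro ⟨m, hm, rfl⟩
    exact ⟨iM_mem_cotangentFlags_iff.2 hm.1, congrArg (iNil n) hm.2⟩
  · exact fun hm' => exists_iM_eq hm'.1 hm'.2

theorem image_iM_cotangentFlags :
    iM '' cotangentFlags B n = {m' | m' ∈ cotangentFlags (sumForm B ε n) n ∧
      proj m' ∈ iNil n '' nilcone B n} := by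
  ext m'
  constructor
  · rintro ⟨m, hm, rfl⟩
    exact ⟨iM_mem_cotangentFlags_iff.2 hm, m.1, hm.1, rfl⟩
  · rintro ⟨hm', x, -, hx⟩
    obtain ⟨m, hm, rfl⟩ := exists_iM_eq hm' hx.symm
    exact ⟨m, hm.1, rfl⟩

theorem finrank_ker_iNil_pow [FiniteDimensional ℂ V] (x : Module.End ℂ V) (k : ℕ) :
    Module.finrank ℂ (LinearMap.ker (iNil n x ^ k)) =
      Module.finrank ℂ (LinearMap.ker (x ^ k)) + 2 * min k n := by
  rw [iNil_pow, LinearMap.ker_prodMap, finrank_submodule_prod, finrank_ker_stdNilp_pow]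

/-- The standard flag has step dimensions `2 * i`, so each successive quotient grows by `2`. -/
theorem hasDims_iFlag_iff [FiniteDimensional ℂ V] {F : Fin (n + 1) → Submodule ℂ V}
    {d : Fin n → ℕ} : HasDims (iFlag F) (fun i => d i + 2) ↔ HasDims F d := by
  refine forall_congr' fun i => ?_
  rw [iFlag, iFlag, finrank_submodule_prod, finrank_submodule_prod, finrank_stdFlag,
    finrank_stdFlag, Fin.val_succ, Fin.val_castSucc]
  dsimp only
  omega

theorem image_iM_spaltenstein [FiniteDimensional ℂ V] (d : Fin n → ℕ) (x : Module.End ℂ V) :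
    iM '' spaltenstein B d x = spaltenstein (sumForm B ε n) (fun i => d i + 2) (iNil n x) := by
  ext m'
  constructor
  · rintro ⟨m, hm, rfl⟩
    exact ⟨image_iM_fiber x ▸ ⟨m, hm.1, rfl⟩, hasDims_iFlag_iff.2 hm.2⟩
  · intro hm'
    obtain ⟨m, hm, rfl⟩ := exists_iM_eq hm'.1.1 hm'.1.2
    exact ⟨m, ⟨hm, hasDims_iFlag_iff.1 hm'.2⟩, rfl⟩

end Sum

/-! ### Isometries -/

section Isometry

variable {n : ℕ} {V : Type*} [AddCommGroup V] [Module ℂ V]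
variable {V' : Type*} [AddCommGroup V'] [Module ℂ V']

theorem orthogonal_map {B : LinearMap.BilinForm ℂ V} {B' : LinearMap.BilinForm ℂ V'}
    {g : V ≃ₗ[ℂ] V'} (hg : ∀ u w, B' (g u) (g w) = B u w) (p : Submodule ℂ V) :
    B'.orthogonal (p.map g.toLinearMap) = (B.orthogonal p).map g.toLinearMap := by
  ext w
  obtain ⟨w, rfl⟩ := g.surjective w
  rw [LinearMap.BilinForm.mem_orthogonal_iff]
  constructor
  · refine fun h => ⟨w, LinearMap.BilinForm.mem_orthogonal_iff.2 fun u hu => ?_, rfl⟩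
    rw [← hg]
    exact h _ ⟨u, hu, rfl⟩
  · rintro ⟨w', hw', e⟩ _ ⟨u, hu, rfl⟩
    rw [← e]
    exact (hg u w').trans (LinearMap.BilinForm.mem_orthogonal_iff.1 hw' u hu)

theorem mapsTo_transport_spaltenstein {B : LinearMap.BilinForm ℂ V}
    {B' : LinearMap.BilinForm ℂ V'} {g : V ≃ₗ[ℂ] V'} (hg : ∀ u w, B' (g u) (g w) = B u w)
    (d : Fin n → ℕ) (x : Module.End ℂ V) :
    Set.MapsTo (transport g) (spaltenstein B d x) (spaltenstein B' d (g.conj x)) := by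
  rintro m ⟨⟨⟨hx, ⟨h0, h1, hmono, horth⟩, hsub⟩, rfl⟩, hd⟩
  rw [mem_nilcone_iff] at hx
  refine ⟨⟨⟨mem_nilcone_iff.2 ⟨fun u w => ?_, ?_⟩, ⟨?_, ?_, fun i j hij => ?_, fun i => ?_⟩,
    fun i => ?_⟩, rfl⟩, fun i => ?_⟩
  · obtain ⟨u, rfl⟩ := g.surjective u
    obtain ⟨w, rfl⟩ := g.surjective w
    simp only [transport, LinearEquiv.conj_apply_apply, LinearEquiv.symm_apply_apply, hg]
    exact hx.1 u w
  · have h := map_pow (g.conjAlgEquiv ℂ) m.1 n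
    rw [hx.2, map_zero] at h
    exact h.symm
  · simp [transport, h0]
  · simp [transport, h1]
  · exact Submodule.map_mono (hmono hij)
  · simp only [transport]
    rw [orthogonal_map hg, horth]
  · rintro _ ⟨_, ⟨v, hv, rfl⟩, rfl⟩
    exact ⟨m.1 v, hsub i ⟨v, hv, rfl⟩, by simp [transport]⟩
  · exact (LinearEquiv.finrank_map_eq g _).trans
      ((hd i).trans (congrArg (· + d i) (LinearEquiv.finrank_map_eq g _).symm))

theorem isVarietyIso_transport_spaltenstein {B : LinearMap.BilinForm ℂ V}
    {B' : LinearMap.BilinForm ℂ V'} {g : V ≃ₗ[ℂ] V'} (hg : ∀ u w, B' (g u) (g w) = B u w)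
    (d : Fin n → ℕ) (x : Module.End ℂ V) :
    IsVarietyIso (transport g) (spaltenstein B d x) (spaltenstein B' d (g.conj x)) := by
  refine isVarietyIso_transport g (mapsTo_transport_spaltenstein hg d x) ?_
  have hg' : ∀ u w, B (g.symm u) (g.symm w) = B' u w := fun u w => by
    rw [← hg, g.apply_symm_apply, g.apply_symm_apply]
  have h := mapsTo_transport_spaltenstein hg' d (g.conj x)
  have e : g.symm.conj (g.conj x) = x := by
    ext v
    simp
  rwa [e] at h

end Isometry

end Nilcone

/-! ### Assembly of the cartesian square and the row reduction -/

theorem mainTheorem11 {V : Type*} [AddCommGroup V] [Module ℂ V] [FiniteDimensional ℂ V]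
    (n : ℕ) (hn : 2 ≤ n) (ε : ℤˣ) (B : LinearMap.BilinForm ℂ V) (hB : Nilcone.IsEpsForm ε B) :
    -- the square is a well defined commutative square
    Nilcone.IsEpsForm ε (Nilcone.sumForm B ε n) ∧
    Set.MapsTo (Nilcone.iNil n) (Nilcone.nilcone B n)
      (Nilcone.nilcone (Nilcone.sumForm B ε n) n) ∧
    Set.MapsTo Nilcone.iM (Nilcone.cotangentFlags B n)
      (Nilcone.cotangentFlags (Nilcone.sumForm B ε n) n) ∧
    (∀ m ∈ Nilcone.cotangentFlags B n,
      Nilcone.proj (Nilcone.iM m) = Nilcone.iNil n (Nilcone.proj m)) ∧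
    -- it is cartesian
    (∀ x ∈ Nilcone.nilcone B n,
      Nilcone.iM '' Nilcone.fiber B n x =
        Nilcone.fiber (Nilcone.sumForm B ε n) n (Nilcone.iNil n x)) ∧
    (∀ x ∈ Nilcone.nilcone B n, ∀ m' ∈ Nilcone.cotangentFlags (Nilcone.sumForm B ε n) n,
      Nilcone.proj m' = Nilcone.iNil n x →
        ∃! m : Nilcone.Pt n V,
          m ∈ Nilcone.cotangentFlags B n ∧ Nilcone.iM m = m' ∧ Nilcone.proj m = x) ∧
    Nilcone.IsVarietyIso Nilcone.iM (Nilcone.cotangentFlags B n)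
      {m' | m' ∈ Nilcone.cotangentFlags (Nilcone.sumForm B ε n) n ∧
        Nilcone.proj m' ∈ Nilcone.iNil n '' Nilcone.nilcone B n} ∧
    -- fibres and Spaltenstein varieties do not change under row reduction
    (∀ x ∈ Nilcone.nilcone B n,
      (∀ k : ℕ, Module.finrank ℂ (LinearMap.ker (Nilcone.iNil n x ^ k)) =
        Module.finrank ℂ (LinearMap.ker (x ^ k)) + 2 * min k n) ∧
      Nilcone.IsVarietyIso Nilcone.iM (Nilcone.fiber B n x)
        (Nilcone.fiber (Nilcone.sumForm B ε n) n (Nilcone.iNil n x)) ∧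
      ∀ d : Fin n → ℕ,
        Nilcone.IsVarietyIso Nilcone.iM (Nilcone.spaltenstein B d x)
          (Nilcone.spaltenstein (Nilcone.sumForm B ε n) (fun i => d i + 2) (Nilcone.iNil n x)) ∧
        ∀ {V' : Type*} [AddCommGroup V'] [Module ℂ V'] (B' : LinearMap.BilinForm ℂ V')
          (x' : Module.End ℂ V') (g : (V × Nilcone.Std n) ≃ₗ[ℂ] V'),
          (∀ u w, B' (g u) (g w) = Nilcone.sumForm B ε n u w) →
          x' = g.conj (Nilcone.iNil n x) →
          ∃ φ : Nilcone.Pt n V → Nilcone.Pt n V',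
            Nilcone.IsVarietyIso φ (Nilcone.spaltenstein B d x)
              (Nilcone.spaltenstein B' (fun i => d i + 2) x')) := by
  have hsp (x : Module.End ℂ V) (d : Fin n → ℕ) :
      Nilcone.IsVarietyIso Nilcone.iM (Nilcone.spaltenstein B d x)
        (Nilcone.spaltenstein (Nilcone.sumForm B ε n) (fun i => d i + 2) (Nilcone.iNil n x)) := by
    rw [← Nilcone.image_iM_spaltenstein]
    exact Nilcone.isVarietyIso_iM _
  refine ⟨Nilcone.isEpsForm_sumForm hB, fun _ hx => Nilcone.iNil_mem_nilcone_iff.2 hx,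
    fun _ hm => Nilcone.iM_mem_cotangentFlags_iff.2 hm, fun _ _ => rfl,
    fun x _ => Nilcone.image_iM_fiber x, fun x _ m' hm' hx => ?_, ?_, fun x _ =>
      ⟨Nilcone.finrank_ker_iNil_pow x, ?_, fun d => ⟨hsp x d, ?_⟩⟩⟩
  · obtain ⟨m, hm, h⟩ := Nilcone.exists_iM_eq hm' hx
    exact ⟨m, ⟨hm.1, h, hm.2⟩, fun m₁ h₁ => Nilcone.iM_injective (h₁.2.1.trans h.symm)⟩
  · rw [← Nilcone.image_iM_cotangentFlags]
    exact Nilcone.isVarietyIso_iM _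
  · rw [← Nilcone.image_iM_fiber]
    exact Nilcone.isVarietyIso_iM _
  · intro V' _ _ B' x' g hg hx'
    refine ⟨Nilcone.transport g ∘ Nilcone.iM, ?_⟩
    rw [hx']
    exact (Nilcone.isVarietyIso_transport_spaltenstein hg _ _).comp (hsp x d)
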